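/- Let $(M,g)$ be a compact connected smooth Riemannian manifold without boundary, let $n\ge 1$, and let $S^n\subset\mathbb{R}^{n+1}$ be the unit sphere with its canonical metric. Let $a,b\in\mathbb{R}^{n+1}$ be orthonormal and let $$H_{a,b}=\{x\in S^n:\ \langle x,a\rangle=0,\ \langle x,b\rangle\ge 0\}$$ be the corresponding closed half-equator (for $a=e_1$, $b=e_2$ this is $\overline{S}^{\,n-1}_+=\{x\in S^n: x_1=0,\ x_2\ge 0\}$). Let $u:M\to S^n$ be a harmonic map, i.e. a smooth map that is a critical point of the energy $E(u)=\frac12\int_M|du|^2\,d\mathrm{vol}_g$: $\frac{d}{dt}\big|_{t=0}E(u_t)=0$ for every smooth variation $u_t$ $(t\in\mathbb{R})$ with $u_0=u$. If $u(M)\subset S^n\setminus H_{a,b}$, then $u$ is constant. -/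

import Mathlib

open Set MeasureTheory Metric Manifold Bundle
open scoped ContDiff

noncomputable section

/-! ### The round metric on the unit sphere -/

/-- The differential at `x` of the inclusion `S^n → ℝ^{n+1}`. -/
def sphereInclusionDeriv (n : ℕ) (x : sphere (0 : EuclideanSpace ℝ (Fin (n + 1))) 1) :
    TangentSpace (𝓡 n) x →L[ℝ] EuclideanSpace ℝ (Fin (n + 1)) :=
  mvfderiv (𝓡 n)
    (fun y : sphere (0 : EuclideanSpace ℝ (Fin (n + 1))) 1 =>
      (y : EuclideanSpace ℝ (Fin (n + 1)))) x

theorem sphereInclusionDeriv_injective (n : ℕ)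
    (x : sphere (0 : EuclideanSpace ℝ (Fin (n + 1))) 1) :
    Function.Injective (sphereInclusionDeriv n x) := by
  have := Fact.mk (@finrank_euclideanSpace_fin ℝ _ (n + 1))
  exact injective_mvfderiv_subtypeVal_sphere x

/-- The canonical metric of `S^n`: the metric induced from the Euclidean inner product of
`ℝ^{n+1}`. -/
def sphereMetric (n : ℕ) : RiemannianMetric
    (fun x : sphere (0 : EuclideanSpace ℝ (Fin (n + 1))) 1 => TangentSpace (𝓡 n) x) where
  inner x :=
    let L : EuclideanSpace ℝ (Fin n) →L[ℝ] EuclideanSpace ℝ (Fin (n + 1)) :=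
      sphereInclusionDeriv n x
    ((innerSL ℝ).bilinearComp L L :
      EuclideanSpace ℝ (Fin n) →L[ℝ] EuclideanSpace ℝ (Fin n) →L[ℝ] ℝ)
  symm x v w := real_inner_comm (sphereInclusionDeriv n x w) (sphereInclusionDeriv n x v)
  pos x v hv := by
    have h : sphereInclusionDeriv n x v ≠ 0 := fun h0 =>
      hv (sphereInclusionDeriv_injective n x (h0.trans (map_zero _).symm))
    exact real_inner_self_pos.2 h
  continuousAt x := by
    have h : Continuous fun v : TangentSpace (𝓡 n) x =>
        inner ℝ (sphereInclusionDeriv n x v) (sphereInclusionDeriv n x v) :=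
      (sphereInclusionDeriv n x).continuous.inner (sphereInclusionDeriv n x).continuous
    exact h.continuousAt
  isVonNBounded x := by
    let L : EuclideanSpace ℝ (Fin n) →L[ℝ] EuclideanSpace ℝ (Fin (n + 1)) :=
      sphereInclusionDeriv n x
    have hinj : Function.Injective (L : EuclideanSpace ℝ (Fin n) →ₗ[ℝ]
        EuclideanSpace ℝ (Fin (n + 1))) := sphereInclusionDeriv_injective n x
    have hL := LinearMap.ker_eq_bot.2 hinj
    obtain ⟨K, -, hK⟩ := LinearMap.exists_antilipschitzWith
      (L : EuclideanSpace ℝ (Fin n) →ₗ[ℝ] EuclideanSpace ℝ (Fin (n + 1))) hL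
    change Bornology.IsVonNBounded ℝ
      {v : EuclideanSpace ℝ (Fin n) | inner ℝ (L v) (L v) < 1}
    refine (NormedSpace.isVonNBounded_closedBall ℝ (EuclideanSpace ℝ (Fin n)) K).subset ?_
    intro v hv
    have h1 : ‖L v‖ ≤ 1 := by
      have h2 : inner ℝ (L v) (L v) < 1 := hv
      rw [real_inner_self_eq_norm_sq] at h2
      nlinarith [norm_nonneg (L v)]
    have h3 : ‖v‖ ≤ K * ‖L v‖ := by
      simpa using hK.le_mul_dist v 0
    rw [mem_closedBall_zero_iff]
    calc ‖v‖ ≤ K * ‖L v‖ := h3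
      _ ≤ K * 1 := by gcongr
      _ = K := mul_one _

instance sphereRiemannianBundle (n : ℕ) : RiemannianBundle
    (fun x : sphere (0 : EuclideanSpace ℝ (Fin (n + 1))) 1 => TangentSpace (𝓡 n) x) :=
  ⟨sphereMetric n⟩

theorem sphere_inner_eq (n : ℕ) (x : sphere (0 : EuclideanSpace ℝ (Fin (n + 1))) 1)
    (v w : TangentSpace (𝓡 n) x) :
    inner ℝ v w = (inner ℝ (sphereInclusionDeriv n x v) (sphereInclusionDeriv n x w) : ℝ) :=
  rfl

/-! ### Riemannian volume, energy and harmonic maps -/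

/-- `√(det (g_ij))` at the point `x` of the coordinate domain of the chart around `p`, where
`g_ij` is the inner product of the `i`-th and the `j`-th coordinate vector field. -/
def chartVolumeDensity {m : ℕ} {M : Type*} [TopologicalSpace M]
    [ChartedSpace (EuclideanSpace ℝ (Fin m)) M]
    [RiemannianBundle (fun x : M => TangentSpace (𝓡 m) x)]
    (p : M) (x : EuclideanSpace ℝ (Fin m)) : ℝ :=
  let φ := chartAt (EuclideanSpace ℝ (Fin m)) p
  let e : Fin m → TangentSpace (𝓡 m) (φ.symm x) := fun i =>
    mfderiv (𝓡 m) (𝓡 m) φ.symm x (EuclideanSpace.single i (1 : ℝ))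
  Real.sqrt (Matrix.of fun i j => (inner ℝ (e i) (e j) : ℝ)).det

/-- The Riemannian volume measure `√(det (g_ij)) dx¹ … dxᵐ`, glued from the charts by a smooth
partition of unity subordinate to them (the result does not depend on the partition). -/
def riemannianVolume (m : ℕ) (M : Type*) [TopologicalSpace M] [T2Space M] [SigmaCompactSpace M]
    [ChartedSpace (EuclideanSpace ℝ (Fin m)) M] [IsManifold (𝓡 m) ∞ M]
    [RiemannianBundle (fun x : M => TangentSpace (𝓡 m) x)] [MeasurableSpace M] : Measure M :=
  let ρ := (SmoothPartitionOfUnity.exists_isSubordinate_chartAt_source (𝓡 m) M).choose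
  Measure.sum fun p : M =>
    let φ := chartAt (EuclideanSpace ℝ (Fin m)) p
    ((volume.restrict φ.target).withDensity fun x =>
      ENNReal.ofReal (ρ p (φ.symm x) * chartVolumeDensity p x)).map φ.symm

/-- `|du|²(x) = ∑_α |du(e_α)|²` for an orthonormal basis `(e_α)` of `T_x M` (the sum does not
depend on the basis). -/
def normSqDifferential {m n : ℕ} {M N : Type*}
    [TopologicalSpace M] [ChartedSpace (EuclideanSpace ℝ (Fin m)) M]
    [RiemannianBundle (fun x : M => TangentSpace (𝓡 m) x)]
    [TopologicalSpace N] [ChartedSpace (EuclideanSpace ℝ (Fin n)) N]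
    [RiemannianBundle (fun y : N => TangentSpace (𝓡 n) y)]
    (u : M → N) (x : M) : ℝ :=
  haveI : FiniteDimensional ℝ (TangentSpace (𝓡 m) x) :=
    inferInstanceAs (FiniteDimensional ℝ (EuclideanSpace ℝ (Fin m)))
  ∑ α, ‖mfderiv (𝓡 m) (𝓡 n) u x (stdOrthonormalBasis ℝ (TangentSpace (𝓡 m) x) α)‖ ^ 2

/-- The energy `E(u) = ½ ∫_M |du|² dvol` of a smooth map on a compact Riemannian manifold. -/
def mapEnergy {m n : ℕ} {M N : Type*}
    [TopologicalSpace M] [T2Space M] [CompactSpace M]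
    [ChartedSpace (EuclideanSpace ℝ (Fin m)) M] [IsManifold (𝓡 m) ∞ M]
    [RiemannianBundle (fun x : M => TangentSpace (𝓡 m) x)] [MeasurableSpace M]
    [TopologicalSpace N] [ChartedSpace (EuclideanSpace ℝ (Fin n)) N]
    [RiemannianBundle (fun y : N => TangentSpace (𝓡 n) y)]
    (u : M → N) : ℝ :=
  (1 / 2) * ∫ x, normSqDifferential (m := m) (n := n) u x ∂(riemannianVolume m M)

/-- A harmonic map from a compact Riemannian manifold (without boundary): a smooth map which is a
critical point of the energy, that is, `d/dt E(u_t) = 0` at `t = 0` for every smooth variation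
`(u_t)` with `u_0 = u`. -/
def IsHarmonicMap (m n : ℕ) {M N : Type*}
    [TopologicalSpace M] [T2Space M] [CompactSpace M]
    [ChartedSpace (EuclideanSpace ℝ (Fin m)) M] [IsManifold (𝓡 m) ∞ M]
    [RiemannianBundle (fun x : M => TangentSpace (𝓡 m) x)] [MeasurableSpace M]
    [TopologicalSpace N] [ChartedSpace (EuclideanSpace ℝ (Fin n)) N]
    [RiemannianBundle (fun y : N => TangentSpace (𝓡 n) y)]
    (u : M → N) : Prop :=
  ContMDiff (𝓡 m) (𝓡 n) ∞ u ∧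
    ∀ U : ℝ → M → N,
      ContMDiff (𝓘(ℝ, ℝ).prod (𝓡 m)) (𝓡 n) ∞ (fun q : ℝ × M => U q.1 q.2) →
      U 0 = u →
      HasDerivAt (fun t : ℝ => mapEnergy (m := m) (n := n) (U t)) 0 0

/-! ### Half-equators -/

/-- The closed half-equator `{x ∈ S^n : ⟨x, a⟩ = 0, ⟨x, b⟩ ≥ 0}` determined by an orthonormal
pair `a`, `b`. For `a = e₁`, `b = e₂` it is `{x ∈ S^n : x₁ = 0, x₂ ≥ 0}`, and the others are its
images under rotations. -/
def closedHalfEquator {n : ℕ} (a b : EuclideanSpace ℝ (Fin (n + 1))) :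
    Set (sphere (0 : EuclideanSpace ℝ (Fin (n + 1))) 1) :=
  {x | inner ℝ (x : EuclideanSpace ℝ (Fin (n + 1))) a = 0 ∧
    0 ≤ inner ℝ (x : EuclideanSpace ℝ (Fin (n + 1))) b}

end

/-!
Write `x = ⟨a, u⟩`, `y = ⟨b, u⟩` and `r² = x² + y²`. Since `u` avoids the half-equator, the complex
number `-y + i x` lies in the slit plane, so it has a smooth argument `θ : M → ℝ` and `r > 0`.
The proof tests the energy with two variations, each given by explicit maps of the sphere.

Rotating `u(x)` in the plane of `a` and `b` by the angle `t θ(x)` changes the energy density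
from `|du|²` to `|du|² + (2t + t²) r² |dθ|²` (`norm_fderiv_planeTwist_sq`). Harmonicity therefore
gives `∫ r² |dθ|² = 0`, and `θ` is constant (`IsHarmonicMap.exists_planeAngle_eq_const`).

For constant `θ` the vector `c = sin θ a - cos θ b` satisfies `⟨c, u⟩ = r > 0`, so `u` takes values
in an open hemisphere. There the variation `(u + s c) / |u + s c|` with `s = sin t / 2` satisfies
`|du_t|² ≤ |du|² / (1 + 2 s δ)` for `s ≥ 0`, where `δ > 0` is a lower bound of `⟨c, u⟩`
(`norm_mul_norm_fderiv_radialProjection_le`). Comparing right derivatives at `t = 0` gives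
`δ E(u) ≤ 0`, hence `du = 0` (`IsHarmonicMap.exists_eq_const_of_inner_pos`).

Both steps use that the Riemannian volume is finite and positive on nonempty open sets, and that
the energy density is continuous. The last point is not immediate from the definition, which uses a
discontinuous choice of orthonormal bases; it follows from the formula
`|du|² = ∑ g^{ij} ⟨∂ᵢu, ∂ⱼu⟩` (`sum_norm_sq_eq_sum_inv_gram`).
-/

noncomputable section

/-! ### Coordinate vector fields and the metric in a chart -/

section Coordinates

variable {m : ℕ} {M : Type*} [TopologicalSpace M] [ChartedSpace (EuclideanSpace ℝ (Fin m)) M]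

/-- The `i`-th coordinate vector field of the chart around `p`, as a function of the point `z` of
the coordinate domain. -/
def coordField (p : M) (i : Fin m) (z : EuclideanSpace ℝ (Fin m)) :
    TangentSpace (𝓡 m) ((chartAt (EuclideanSpace ℝ (Fin m)) p).symm z) :=
  mfderiv (𝓡 m) (𝓡 m) (chartAt (EuclideanSpace ℝ (Fin m)) p).symm z
    (EuclideanSpace.single i (1 : ℝ))

section

variable [IsManifold (𝓡 m) ∞ M]

theorem continuousOn_coordField (p : M) (i : Fin m) :
    ContinuousOn (fun z => (⟨_, coordField p i z⟩ : TangentBundle (𝓡 m) M))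
      (chartAt (EuclideanSpace ℝ (Fin m)) p).target := by
  set φ := chartAt (EuclideanSpace ℝ (Fin m)) p
  have h := (contMDiffOn_chart_symm (I := 𝓡 m) (n := ∞) (x := p)).continuousOn_tangentMapWithin
    (by simp) φ.open_target.uniqueMDiffOn
  let s : EuclideanSpace ℝ (Fin m) → TangentBundle (𝓡 m) (EuclideanSpace ℝ (Fin m)) :=
    fun z => ⟨z, EuclideanSpace.single i (1 : ℝ)⟩
  have hs : Continuous s := by
    have := (tangentBundleModelSpaceHomeomorph (𝓡 m)).symm.continuous.comp
      (Continuous.prodMk_left (X := EuclideanSpace ℝ (Fin m)) (EuclideanSpace.single i (1 : ℝ)))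
    exact this
  refine (h.comp hs.continuousOn (fun z hz => hz)).congr fun z hz => ?_
  have := tangentMapWithin_eq_tangentMap (I := 𝓡 m) (I' := 𝓡 m) (f := φ.symm) (p := s z)
    (φ.open_target.uniqueMDiffOn z hz)
    ((mdifferentiable_chart p).mdifferentiableAt_symm hz)
  exact this.symm

theorem linearIndependent_coordField (p : M) {z : EuclideanSpace ℝ (Fin m)}
    (hz : z ∈ (chartAt (EuclideanSpace ℝ (Fin m)) p).target) :
    LinearIndependent ℝ fun i => coordField p i z := by
  have hinj := (mdifferentiable_chart (I := 𝓡 m) p).symm.mfderiv_injective hz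
  have hb := (EuclideanSpace.basisFun (Fin m) ℝ).toBasis.linearIndependent
  let L : EuclideanSpace ℝ (Fin m) →L[ℝ]
      TangentSpace (𝓡 m) ((chartAt (EuclideanSpace ℝ (Fin m)) p).symm z) :=
    mfderiv (𝓡 m) (𝓡 m) (chartAt (EuclideanSpace ℝ (Fin m)) p).symm z
  have h := hb.map' L.toLinearMap (LinearMap.ker_eq_bot.2 hinj)
  have he : (fun i => coordField p i z) =
      L.toLinearMap ∘ (EuclideanSpace.basisFun (Fin m) ℝ).toBasis := by
    ext1 i
    simp only [coordField, L, Function.comp_apply, OrthonormalBasis.coe_toBasis,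
      EuclideanSpace.basisFun_apply]
    rfl
  rw [he]
  exact h

theorem mvfderiv_coordField {V : Type*} [NormedAddCommGroup V] [NormedSpace ℝ V] {F : M → V}
    (hF : ContMDiff (𝓡 m) 𝓘(ℝ, V) ∞ F) (p : M) (i : Fin m) {z : EuclideanSpace ℝ (Fin m)}
    (hz : z ∈ (chartAt (EuclideanSpace ℝ (Fin m)) p).target) :
    mvfderiv (𝓡 m) F _ (coordField p i z) =
      fderiv ℝ (F ∘ (chartAt (EuclideanSpace ℝ (Fin m)) p).symm) z
        (EuclideanSpace.single i (1 : ℝ)) := by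
  have h := mfderiv_comp (I := 𝓡 m) (I' := 𝓡 m) (I'' := 𝓘(ℝ, V)) z
    ((hF.mdifferentiable (by simp)) ((chartAt (EuclideanSpace ℝ (Fin m)) p).symm z))
    ((mdifferentiable_chart (I := 𝓡 m) p).mdifferentiableAt_symm hz)
  rw [mfderiv_eq_fderiv] at h
  rw [h]
  rfl

theorem contDiffOn_comp_chart_symm {V : Type*} [NormedAddCommGroup V] [NormedSpace ℝ V] {F : M → V}
    (hF : ContMDiff (𝓡 m) 𝓘(ℝ, V) ∞ F) (p : M) :
    ContDiffOn ℝ ∞ (F ∘ (chartAt (EuclideanSpace ℝ (Fin m)) p).symm)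
      (chartAt (EuclideanSpace ℝ (Fin m)) p).target :=
  (hF.comp_contMDiffOn (contMDiffOn_chart_symm (I := 𝓡 m) (n := ∞) (x := p))).contDiffOn

/-- On a connected manifold a smooth function with vanishing differential is constant. -/
theorem exists_eq_const_of_mvfderiv_eq_zero [ConnectedSpace M]
    {V : Type*} [NormedAddCommGroup V] [NormedSpace ℝ V] {F : M → V}
    (hF : ContMDiff (𝓡 m) 𝓘(ℝ, V) ∞ F) (h0 : ∀ x, mvfderiv (𝓡 m) F x = 0) :
    ∃ c, ∀ x, F x = c := by
  have hloc : IsLocallyConstant F := by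
    rw [IsLocallyConstant.iff_eventually_eq]
    intro p
    set φ := chartAt (EuclideanSpace ℝ (Fin m)) p with hφ
    have hp : p ∈ φ.source := mem_chart_source _ p
    have hder : EqOn (fderiv ℝ (F ∘ φ.symm)) 0 φ.target := by
      intro z hz
      have : (fderiv ℝ (F ∘ φ.symm) z : EuclideanSpace ℝ (Fin m) →ₗ[ℝ] V) = 0 := by
        refine (EuclideanSpace.basisFun (Fin m) ℝ).toBasis.ext fun i => ?_
        have := mvfderiv_coordField hF p i hz
        rw [h0] at this
        simpa using this.symm
      ext v
      exact LinearMap.congr_fun this v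
    obtain ⟨r, hr, hball⟩ := Metric.isOpen_iff.1 φ.open_target (φ p) (φ.map_source hp)
    have hconst : ∀ z ∈ ball (φ p) r, (F ∘ φ.symm) z = (F ∘ φ.symm) (φ p) := fun z hz =>
      isOpen_ball.is_const_of_fderiv_eq_zero (convex_ball _ _).isPreconnected
        (((contDiffOn_comp_chart_symm hF p).differentiableOn (by simp)).mono hball)
        (hder.mono hball) hz (mem_ball_self hr)
    filter_upwards [φ.open_source.mem_nhds hp,
      (φ.continuousAt hp).preimage_mem_nhds (ball_mem_nhds _ hr)] with x hx hx'
    simpa [φ.left_inv hx, φ.left_inv hp] using hconst _ hx'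
  obtain ⟨x₀⟩ := (inferInstance : Nonempty M)
  exact ⟨F x₀, fun x => hloc.apply_eq_of_isPreconnected isPreconnected_univ trivial trivial⟩

variable [RiemannianBundle (fun x : M => TangentSpace (𝓡 m) x)]

/-- The matrix `(g_ij)` of the Riemannian metric in the chart around `p`. -/
def coordGram (p : M) (z : EuclideanSpace ℝ (Fin m)) : Matrix (Fin m) (Fin m) ℝ :=
  Matrix.gram ℝ fun i => coordField p i z

theorem det_coordGram_pos (p : M) {z : EuclideanSpace ℝ (Fin m)}
    (hz : z ∈ (chartAt (EuclideanSpace ℝ (Fin m)) p).target) : 0 < (coordGram p z).det :=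
  by
  have h := linearIndependent_coordField p hz
  refine Matrix.PosDef.det_pos ?_
  unfold coordGram
  apply Matrix.posDef_gram_of_linearIndependent
  exact h

variable [IsContMDiffRiemannianBundle (𝓡 m) ∞ (EuclideanSpace ℝ (Fin m))
      (fun x : M => TangentSpace (𝓡 m) x)]

theorem continuousOn_coordGram (p : M) :
    ContinuousOn (coordGram p) (chartAt (EuclideanSpace ℝ (Fin m)) p).target := by
  have : IsContinuousRiemannianBundle (EuclideanSpace ℝ (Fin m))
    (fun x : M => TangentSpace (𝓡 m) x) := by
    obtain ⟨g, hg, hgi⟩ := IsContMDiffRiemannianBundle.exists_contMDiff (IB := 𝓡 m) (n := ∞)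
      (F := EuclideanSpace ℝ (Fin m)) (E := fun x : M => TangentSpace (𝓡 m) x)
    exact ⟨g, hg.continuous, hgi⟩
  refine continuousOn_pi.2 fun i => continuousOn_pi.2 fun j => ?_
  exact (continuousOn_coordField p i).inner_bundle (continuousOn_coordField p j)

theorem continuousOn_chartVolumeDensity (p : M) :
    ContinuousOn (chartVolumeDensity p) (chartAt (EuclideanSpace ℝ (Fin m)) p).target :=
  Real.continuous_sqrt.comp_continuousOn
    ((continuous_id.matrix_det).comp_continuousOn (continuousOn_coordGram p))

end
end Coordinates

/-! ### The energy density of sphere-valued maps -/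

/-- The Hilbert–Schmidt norm of `L`, computed in an arbitrary basis `b` with the inverse of its
Gram matrix. -/
theorem sum_norm_sq_eq_sum_inv_gram {V W ι κ : Type*} [NormedAddCommGroup V]
    [InnerProductSpace ℝ V] [NormedAddCommGroup W] [InnerProductSpace ℝ W] [Fintype ι] [Fintype κ]
    [DecidableEq κ] (e : OrthonormalBasis ι ℝ V) (hcard : Fintype.card ι = Fintype.card κ)
    {b : κ → V} (hb : LinearIndependent ℝ b) (L : V →L[ℝ] W) :
    ∑ α, ‖L (e α)‖ ^ 2 =
      ∑ i, ∑ j, (Matrix.gram ℝ b)⁻¹ i j * inner ℝ (L (b i)) (L (b j)) := by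
  obtain ⟨σ⟩ := Fintype.card_eq.1 hcard
  let e' := e.reindex σ
  have hsum : ∑ α, ‖L (e α)‖ ^ 2 = ∑ k, ‖L (e' k)‖ ^ 2 :=
    Fintype.sum_equiv σ _ _ fun α => by simp [e']
  let A : Matrix κ κ ℝ := Matrix.of fun i j => e'.repr (b j) i
  have hG : Matrix.gram ℝ b = A.transpose * A := by
    have := Matrix.gram_eq_conjTranspose_mul e' b
    simpa using! this
  have hdet : A.det ≠ 0 := fun h => Matrix.det_gram_ne_zero_iff_linearIndependent.2 hb (by
    rw [hG, Matrix.det_mul, h, mul_zero])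
  have hA : A * A⁻¹ = 1 := Matrix.mul_nonsing_inv A (isUnit_iff_ne_zero.2 hdet)
  have he : ∀ k, e' k = ∑ i, A⁻¹ i k • b i := by
    intro k
    have h1 : ∀ i, b i = ∑ l, A l i • e' l := fun i => (e'.sum_repr (b i)).symm
    calc e' k = ∑ l, (A * A⁻¹) l k • e' l := by
          rw [hA]; simp [Matrix.one_apply, Finset.sum_ite_eq']
      _ = ∑ l, ∑ i, (A l i * A⁻¹ i k) • e' l := by simp [Matrix.mul_apply, Finset.sum_smul]
      _ = ∑ i, ∑ l, (A l i * A⁻¹ i k) • e' l := Finset.sum_comm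
      _ = ∑ i, A⁻¹ i k • b i := by
          refine Finset.sum_congr rfl fun i _ => ?_
          conv_rhs => rw [h1 i]
          simp [Finset.smul_sum, smul_smul, mul_comm]
  rw [hsum, hG, Matrix.mul_inv_rev, ← Matrix.transpose_nonsing_inv]
  calc ∑ k, ‖L (e' k)‖ ^ 2
      = ∑ k, ∑ i, ∑ j, A⁻¹ i k * A⁻¹ j k * inner ℝ (L (b i)) (L (b j)) := by
        refine Finset.sum_congr rfl fun k _ => ?_
        rw [← real_inner_self_eq_norm_sq, he k]
        simp only [map_sum, map_smul, sum_inner, inner_sum, inner_smul_left, inner_smul_right,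
          conj_trivial, mul_assoc, Finset.mul_sum]
        exact Finset.sum_congr rfl fun i _ => Finset.sum_congr rfl fun j _ => by
          rw [real_inner_comm]
    _ = ∑ i, ∑ j, ∑ k, A⁻¹ i k * A⁻¹ j k * inner ℝ (L (b i)) (L (b j)) := by
        rw [Finset.sum_comm]
        exact Finset.sum_congr rfl fun i _ => Finset.sum_comm
    _ = _ := by
        simp [Matrix.mul_apply, Finset.sum_mul]

section Sphere

variable {m n : ℕ} {M : Type*} [TopologicalSpace M] [ChartedSpace (EuclideanSpace ℝ (Fin m)) M]

instance finiteDimensional_tangentSpace (x : M) : FiniteDimensional ℝ (TangentSpace (𝓡 m) x) :=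
  inferInstanceAs (FiniteDimensional ℝ (EuclideanSpace ℝ (Fin m)))

theorem contMDiff_coe_comp {u : M → sphere (0 : EuclideanSpace ℝ (Fin (n + 1))) 1}
    (hu : ContMDiff (𝓡 m) (𝓡 n) ∞ u) :
    ContMDiff (𝓡 m) 𝓘(ℝ, EuclideanSpace ℝ (Fin (n + 1))) ∞
      fun x => (u x : EuclideanSpace ℝ (Fin (n + 1))) :=
  haveI := Fact.mk (@finrank_euclideanSpace_fin ℝ _ (n + 1))
  contMDiff_coe_sphere.comp hu

theorem norm_mfderiv_sphere {u : M → sphere (0 : EuclideanSpace ℝ (Fin (n + 1))) 1}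
    (hu : ContMDiff (𝓡 m) (𝓡 n) ∞ u) (x : M) (v : TangentSpace (𝓡 m) x) :
    ‖mfderiv (𝓡 m) (𝓡 n) u x v‖ =
      ‖mvfderiv (𝓡 m) (fun x => (u x : EuclideanSpace ℝ (Fin (n + 1)))) x v‖ := by
  have := Fact.mk (@finrank_euclideanSpace_fin ℝ _ (n + 1))
  have h := mfderiv_comp_apply (I := 𝓡 m) (I' := 𝓡 n) (I'' := 𝓘(ℝ, EuclideanSpace ℝ (Fin (n + 1))))
    (g := fun y : sphere (0 : EuclideanSpace ℝ (Fin (n + 1))) 1 =>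
      (y : EuclideanSpace ℝ (Fin (n + 1)))) (f := u) x
    (contMDiff_coe_sphere.mdifferentiable (n := ∞) (by simp) (u x))
    (hu.mdifferentiable (by simp) x) v
  have h2 : mvfderiv (𝓡 m) (fun x => (u x : EuclideanSpace ℝ (Fin (n + 1)))) x v =
    sphereInclusionDeriv n (u x) (mfderiv (𝓡 m) (𝓡 n) u x v) := h
  rw [h2, norm_eq_sqrt_real_inner, norm_eq_sqrt_real_inner, sphere_inner_eq]

variable [RiemannianBundle (fun x : M => TangentSpace (𝓡 m) x)]

/-- The energy density of a sphere-valued map is that of the underlying vector-valued map. -/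
theorem normSqDifferential_sphere {u : M → sphere (0 : EuclideanSpace ℝ (Fin (n + 1))) 1}
    (hu : ContMDiff (𝓡 m) (𝓡 n) ∞ u) (x : M) :
    normSqDifferential (m := m) (n := n) u x =
      ∑ α, ‖mvfderiv (𝓡 m) (fun x => (u x : EuclideanSpace ℝ (Fin (n + 1)))) x
        (stdOrthonormalBasis ℝ (TangentSpace (𝓡 m) x) α)‖ ^ 2 := by
  unfold normSqDifferential
  simp only [norm_mfderiv_sphere hu]

theorem normSqDifferential_nonneg (u : M → sphere (0 : EuclideanSpace ℝ (Fin (n + 1))) 1) (x : M) :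
    0 ≤ normSqDifferential (m := m) (n := n) u x :=
  Finset.sum_nonneg fun _ _ => sq_nonneg _

variable [IsManifold (𝓡 m) ∞ M] [IsContMDiffRiemannianBundle (𝓡 m) ∞ (EuclideanSpace ℝ (Fin m))
      (fun x : M => TangentSpace (𝓡 m) x)]

/-- The energy density is continuous: in a chart it is `∑ g^{ij} ⟨∂ᵢu, ∂ⱼu⟩`. -/
theorem continuous_normSqDifferential {u : M → sphere (0 : EuclideanSpace ℝ (Fin (n + 1))) 1}
    (hu : ContMDiff (𝓡 m) (𝓡 n) ∞ u) :
    Continuous (normSqDifferential (m := m) (n := n) u) := by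
  set F : M → EuclideanSpace ℝ (Fin (n + 1)) := fun x => (u x : EuclideanSpace ℝ (Fin (n + 1)))
    with hFdef
  have hF : ContMDiff (𝓡 m) 𝓘(ℝ, EuclideanSpace ℝ (Fin (n + 1))) ∞ F := contMDiff_coe_comp hu
  rw [continuous_iff_continuousAt]
  intro p
  set φ := chartAt (EuclideanSpace ℝ (Fin m)) p with hφ
  let D : Fin m → EuclideanSpace ℝ (Fin m) → EuclideanSpace ℝ (Fin (n + 1)) := fun i z =>
    fderiv ℝ (F ∘ φ.symm) z (EuclideanSpace.single i (1 : ℝ))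
  have hD : ∀ i, ContinuousOn (D i) φ.target := fun i =>
    ((contDiffOn_comp_chart_symm hF p).continuousOn_fderiv_of_isOpen φ.open_target
      (by simp)).clm_apply continuousOn_const
  have hinv : ContinuousOn (fun z => (coordGram p z)⁻¹) φ.target := by
    have hG : ContinuousOn (coordGram p) φ.target := continuousOn_coordGram p
    have hdet := (continuous_id.matrix_det).comp_continuousOn hG
    have hadj := (continuous_id.matrix_adjugate).comp_continuousOn hG
    refine ((hdet.inv₀ fun z hz => (det_coordGram_pos p hz).ne').smul hadj).congr fun z hz => ?_
    simp [Matrix.inv_def, Function.comp_apply]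
  have hcont : ContinuousOn
      (fun z => ∑ i, ∑ j, (coordGram p z)⁻¹ i j * inner ℝ (D i z) (D j z)) φ.target := by
    refine continuousOn_finsetSum _ fun i _ => continuousOn_finsetSum _ fun j _ => ?_
    exact (continuousOn_pi.1 (continuousOn_pi.1 hinv i) j).mul ((hD i).inner (hD j))
  have heq : ∀ z ∈ φ.target, normSqDifferential (m := m) (n := n) u (φ.symm z) =
      ∑ i, ∑ j, (coordGram p z)⁻¹ i j * inner ℝ (D i z) (D j z) := by
    intro z hz
    rw [normSqDifferential_sphere hu]
    have hcard : Fintype.card (Fin (Module.finrank ℝ (TangentSpace (𝓡 m) (φ.symm z)))) =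
        Fintype.card (Fin m) := by
      simp only [Fintype.card_fin]
      exact finrank_euclideanSpace_fin (𝕜 := ℝ)
    have h := sum_norm_sq_eq_sum_inv_gram
      (stdOrthonormalBasis ℝ (TangentSpace (𝓡 m) (φ.symm z))) hcard
      (linearIndependent_coordField p hz) (mvfderiv (𝓡 m) F (φ.symm z))
    rw [h]
    have hDz : ∀ i, mvfderiv (𝓡 m) F _ (coordField p i z) = D i z := fun i =>
      mvfderiv_coordField hF p i hz
    simp only [← hDz]
    rfl
  have hp : p ∈ φ.source := mem_chart_source _ p
  have h1 : ContinuousAt (fun x => ∑ i, ∑ j, (coordGram p (φ x))⁻¹ i j *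
      inner ℝ (D i (φ x)) (D j (φ x))) p :=
    (hcont.continuousAt (φ.open_target.mem_nhds (φ.map_source hp))).comp
      (f := φ) (φ.continuousAt hp)
  refine h1.congr ?_
  filter_upwards [φ.open_source.mem_nhds hp] with x hx
  rw [← heq _ (φ.map_source hx), φ.left_inv hx]

end Sphere

/-! ### The Riemannian volume -/

section Volume

variable {m : ℕ} {M : Type*} [TopologicalSpace M]
  [ChartedSpace (EuclideanSpace ℝ (Fin m)) M]

theorem aemeasurable_chart_symm [MeasurableSpace M] [BorelSpace M]
    (p : M) (f : EuclideanSpace ℝ (Fin m) → ENNReal) :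
    AEMeasurable (chartAt (EuclideanSpace ℝ (Fin m)) p).symm
      ((volume.restrict (chartAt (EuclideanSpace ℝ (Fin m)) p).target).withDensity f) :=
  ((chartAt (EuclideanSpace ℝ (Fin m)) p).continuousOn_symm.aemeasurable
    (chartAt (EuclideanSpace ℝ (Fin m)) p).open_target.measurableSet).mono_ac
    (withDensity_absolutelyContinuous _ _)

variable [CompactSpace M] [IsManifold (𝓡 m) ∞ M]
  [RiemannianBundle (fun x : M => TangentSpace (𝓡 m) x)]
  [IsContMDiffRiemannianBundle (𝓡 m) ∞ (EuclideanSpace ℝ (Fin m))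
      (fun x : M => TangentSpace (𝓡 m) x)]

/-- The contribution of one chart to the Riemannian volume is finite, because the weight function
has compact support inside the chart. -/
theorem lintegral_chart_weight_lt_top (p : M) {ρ : M → ℝ} (hρ : Continuous ρ)
    (hsupp : tsupport ρ ⊆ (chartAt (EuclideanSpace ℝ (Fin m)) p).source) :
    ∫⁻ x in (chartAt (EuclideanSpace ℝ (Fin m)) p).target,
      ENNReal.ofReal (ρ ((chartAt (EuclideanSpace ℝ (Fin m)) p).symm x) * chartVolumeDensity p x)
      < ⊤ := by
  set φ := chartAt (EuclideanSpace ℝ (Fin m)) p with hφ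
  set K := φ '' tsupport ρ with hK
  have hKc : IsCompact K :=
    (isClosed_tsupport ρ).isCompact.image_of_continuousOn (φ.continuousOn.mono hsupp)
  have hKt : K ⊆ φ.target := by
    rintro _ ⟨x, hx, rfl⟩
    exact φ.map_source (hsupp hx)
  have hcont : ContinuousOn (fun x => ρ (φ.symm x) * chartVolumeDensity p x) φ.target :=
    (hρ.comp_continuousOn φ.continuousOn_symm).mul (continuousOn_chartVolumeDensity p)
  obtain ⟨C, hC⟩ := hKc.exists_bound_of_continuousOn (hcont.mono hKt)
  have hbound : ∀ x ∈ φ.target, ENNReal.ofReal (ρ (φ.symm x) * chartVolumeDensity p x) ≤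
      K.indicator (fun _ => ENNReal.ofReal C) x := by
    intro x hx
    by_cases hxK : x ∈ K
    · rw [indicator_of_mem hxK]
      exact ENNReal.ofReal_le_ofReal ((le_abs_self _).trans (hC x hxK))
    · have h0 : ρ (φ.symm x) = 0 := by
        by_contra h
        exact hxK ⟨φ.symm x, subset_tsupport _ h, φ.right_inv hx⟩
      simp [h0]
  calc _ ≤ ∫⁻ x in φ.target, K.indicator (fun _ => ENNReal.ofReal C) x :=
        setLIntegral_mono' φ.open_target.measurableSet hbound
    _ ≤ ∫⁻ x, K.indicator (fun _ => ENNReal.ofReal C) x := setLIntegral_le_lintegral _ _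
    _ = ENNReal.ofReal C * volume K := by
        rw [lintegral_indicator_const hKc.measurableSet]
    _ < ⊤ := ENNReal.mul_lt_top ENNReal.ofReal_lt_top hKc.measure_lt_top

variable [T2Space M] [MeasurableSpace M] [BorelSpace M]

instance isFiniteMeasure_riemannianVolume : IsFiniteMeasure (riemannianVolume m M) := by
  refine ⟨?_⟩
  have hsub := (SmoothPartitionOfUnity.exists_isSubordinate_chartAt_source (𝓡 m) M).choose_spec
  unfold riemannianVolume
  set ρ := (SmoothPartitionOfUnity.exists_isSubordinate_chartAt_source (𝓡 m) M).choose
  have hfin : {p : M | (Function.support (ρ p)).Nonempty}.Finite :=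
    ρ.locallyFinite.finite_nonempty_of_compact
  simp only
  rw [Measure.sum_apply _ MeasurableSet.univ, tsum_eq_sum (s := hfin.toFinset)]
  · refine ENNReal.sum_lt_top.2 fun p _ => ?_
    rw [Measure.map_apply_of_aemeasurable (aemeasurable_chart_symm p _) MeasurableSet.univ,
      preimage_univ, withDensity_apply _ MeasurableSet.univ, Measure.restrict_univ]
    exact lintegral_chart_weight_lt_top p (ρ p).contMDiff.continuous (hsub p)
  · intro p hp
    have h0 : ∀ x, ρ p x = 0 := by
      intro x
      by_contra hx
      exact hp (hfin.mem_toFinset.2 ⟨x, hx⟩)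
    rw [Measure.map_apply_of_aemeasurable (aemeasurable_chart_symm p _) MeasurableSet.univ,
      preimage_univ, withDensity_apply _ MeasurableSet.univ]
    simp [h0]

instance isOpenPosMeasure_riemannianVolume : (riemannianVolume m M).IsOpenPosMeasure := by
  refine ⟨fun U hU ⟨x₀, hx₀⟩ hzero => ?_⟩
  unfold riemannianVolume at hzero
  set ρ := (SmoothPartitionOfUnity.exists_isSubordinate_chartAt_source (𝓡 m) M).choose
  have hsub : ρ.IsSubordinate (fun x => (chartAt (EuclideanSpace ℝ (Fin m)) x).source) :=
    (SmoothPartitionOfUnity.exists_isSubordinate_chartAt_source (𝓡 m) M).choose_spec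
  simp only at hzero
  obtain ⟨p, hp⟩ := ρ.exists_pos_of_mem (mem_univ x₀)
  rw [Measure.sum_apply _ hU.measurableSet, ENNReal.tsum_eq_zero] at hzero
  have hz := hzero p
  set φ := chartAt (EuclideanSpace ℝ (Fin m)) p with hφ
  have hsource : ∀ x, 0 < ρ p x → x ∈ φ.source := fun x hx =>
    hsub p (subset_tsupport _ hx.ne')
  have hcont : ContinuousOn (fun x => ρ p (φ.symm x) * chartVolumeDensity p x) φ.target :=
    ((ρ p).contMDiff.continuous.comp_continuousOn φ.continuousOn_symm).mul
      (continuousOn_chartVolumeDensity p)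
  rw [Measure.map_apply_of_aemeasurable (aemeasurable_chart_symm p _) hU.measurableSet] at hz
  -- the part of the chart that is sent into `U` and where the weight is positive
  set W := φ.target ∩ φ.symm ⁻¹' (U ∩ {x | 0 < ρ p x}) with hW
  have hWo : IsOpen W := φ.isOpen_inter_preimage_symm
    (hU.inter (isOpen_lt continuous_const (ρ p).contMDiff.continuous))
  have hWne : W.Nonempty := ⟨φ x₀, φ.map_source (hsource _ hp), by
    simp only [mem_preimage, φ.left_inv (hsource _ hp)]
    exact ⟨hx₀, hp⟩⟩
  have hWz : (∫⁻ x in W, ENNReal.ofReal (ρ p (φ.symm x) * chartVolumeDensity p x)) = 0 := by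
    have h1 := measure_mono_null (s := W) (fun x hx => hx.2.1) hz
    rwa [withDensity_apply _ hWo.measurableSet, Measure.restrict_restrict hWo.measurableSet,
      inter_eq_left.2 (fun x hx => hx.1)] at h1
  have hmeas : AEMeasurable (fun x => ENNReal.ofReal (ρ p (φ.symm x) * chartVolumeDensity p x))
      (volume.restrict W) :=
    ((hcont.mono inter_subset_left).aemeasurable hWo.measurableSet).ennreal_ofReal
  rw [lintegral_eq_zero_iff' hmeas] at hWz
  have hfalse : ∀ᵐ x ∂(volume.restrict W), False := by
    filter_upwards [hWz, ae_restrict_mem hWo.measurableSet] with x hx hxW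
    have hpos : 0 < ρ p (φ.symm x) * chartVolumeDensity p x :=
      mul_pos hxW.2.2 (Real.sqrt_pos.2 (det_coordGram_pos p hxW.1))
    exact absurd hx (ENNReal.ofReal_pos.2 hpos).ne'
  have : volume.restrict W = 0 := by simpa using hfalse
  rw [Measure.restrict_eq_zero] at this
  exact (hWo.measure_pos volume hWne).ne' this

theorem integrable_normSqDifferential {n : ℕ}
    {u : M → sphere (0 : EuclideanSpace ℝ (Fin (n + 1))) 1}
    (hu : ContMDiff (𝓡 m) (𝓡 n) ∞ u) :
    Integrable (normSqDifferential (m := m) (n := n) u) (riemannianVolume m M) :=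
  (continuous_normSqDifferential hu).integrable_of_hasCompactSupport
    (HasCompactSupport.of_compactSpace _)

end Volume

/-! ### Rotations in a plane and radial projection -/

section Plane

variable {V : Type*} [NormedAddCommGroup V] [InnerProductSpace ℝ V]

/-- The component of `z` in the plane of `a` and `b`, as the complex number `-⟨b, z⟩ + i ⟨a, z⟩`.
With this choice the half-plane `{⟨a, z⟩ = 0, ⟨b, z⟩ ≥ 0}` is the slit of the principal branch of
the logarithm. -/
def planeCoord (a b : V) : V →L[ℝ] ℂ :=
  Complex.ofRealCLM ∘L (-innerSL ℝ b) + Complex.I • (Complex.ofRealCLM ∘L innerSL ℝ a)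

@[simp]
theorem planeCoord_re (a b z : V) : (planeCoord a b z).re = -inner ℝ b z := by
  simp [planeCoord]

@[simp]
theorem planeCoord_im (a b z : V) : (planeCoord a b z).im = inner ℝ a z := by
  simp [planeCoord]

/-- The angular coordinate in the plane of `a` and `b`, smooth away from the slit. -/
def planeAngle (a b z : V) : ℝ :=
  (Complex.log (planeCoord a b z)).im

theorem contDiffAt_planeAngle {a b z : V} (hz : planeCoord a b z ∈ Complex.slitPlane) :
    ContDiffAt ℝ ∞ (planeAngle a b) z :=
  Complex.imCLM.contDiff.contDiffAt.comp z
    (((Complex.contDiffAt_log hz).restrict_scalars ℝ).comp z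
      (planeCoord a b).contDiff.contDiffAt)

/-- In polar coordinates `r² dθ = x dy - y dx`. -/
theorem normSq_mul_fderiv_planeAngle {a b z : V} (hz : planeCoord a b z ∈ Complex.slitPlane)
    (v : V) :
    (inner ℝ a z ^ 2 + inner ℝ b z ^ 2) * fderiv ℝ (planeAngle a b) z v =
      inner ℝ a z * inner ℝ b v - inner ℝ b z * inner ℝ a v := by
  have h := Complex.imCLM.hasFDerivAt.comp z
    ((Complex.hasStrictFDerivAt_log_real hz).hasFDerivAt.comp z (planeCoord a b).hasFDerivAt)
  have h1 : fderiv ℝ (planeAngle a b) z v =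
      ((planeCoord a b z)⁻¹ * planeCoord a b v).im := by
    have := congrArg (fun L => L v) h.fderiv
    simpa using! this
  have h2 : inner ℝ a z ^ 2 + inner ℝ b z ^ 2 = Complex.normSq (planeCoord a b z) := by
    simp [Complex.normSq_apply]; ring
  have h3 : Complex.normSq (planeCoord a b z) ≠ 0 := by
    simpa using Complex.slitPlane_ne_zero hz
  rw [h1, h2, Complex.mul_im, Complex.inv_re, Complex.inv_im]
  field_simp
  simp
  ring

/-- The rotation by the angle `s` in the plane of the orthonormal vectors `a`, `b`, which fixes
the orthogonal complement of this plane. -/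
def planeRotation (a b : V) (s : ℝ) (z : V) : V :=
  z + ((Real.cos s - 1) * inner ℝ a z - Real.sin s * inner ℝ b z) • a
    + (Real.sin s * inner ℝ a z + (Real.cos s - 1) * inner ℝ b z) • b

theorem norm_add_smul_add_smul_sq {a b : V} (ha : ‖a‖ = 1) (hb : ‖b‖ = 1)
    (hab : inner ℝ a b = (0 : ℝ)) (z : V) (p q : ℝ) :
    ‖z + p • a + q • b‖ ^ 2 =
      ‖z‖ ^ 2 + p ^ 2 + q ^ 2 + 2 * p * inner ℝ a z + 2 * q * inner ℝ b z := by
  rw [norm_add_sq_real, norm_add_sq_real, norm_smul, norm_smul, ha, hb, inner_add_left,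
    inner_smul_right, inner_smul_right, inner_smul_right, inner_smul_left, hab,
    real_inner_comm a z, real_inner_comm b z]
  simp only [mul_one, Real.norm_eq_abs, sq_abs]
  simp
  ring

theorem norm_planeRotation {a b : V} (ha : ‖a‖ = 1) (hb : ‖b‖ = 1)
    (hab : inner ℝ a b = (0 : ℝ)) (s : ℝ) (z : V) : ‖planeRotation a b s z‖ = ‖z‖ := by
  have h : ‖planeRotation a b s z‖ ^ 2 = ‖z‖ ^ 2 := by
    rw [planeRotation, norm_add_smul_add_smul_sq ha hb hab]
    linear_combination (inner ℝ a z ^ 2 + inner ℝ b z ^ 2) * Real.sin_sq_add_cos_sq s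
  exact (sq_eq_sq₀ (norm_nonneg _) (norm_nonneg _)).1 h

/-- Rotation of `z` in the plane of `a` and `b` by `t` times its own angular coordinate. -/
def planeTwist (a b : V) (t : ℝ) (z : V) : V :=
  planeRotation a b (t * planeAngle a b z) z

theorem planeTwist_zero (a b z : V) : planeTwist a b 0 z = z := by
  simp [planeTwist, planeRotation]

theorem contDiffAt_planeTwist {a b : V} (q : ℝ × V)
    (hz : planeCoord a b q.2 ∈ Complex.slitPlane) :
    ContDiffAt ℝ ∞ (fun q : ℝ × V => planeTwist a b q.1 q.2) q := by
  have hA : ContDiffAt ℝ ∞ (fun q : ℝ × V => q.1 * planeAngle a b q.2) q :=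
    contDiffAt_fst.mul ((contDiffAt_planeAngle hz).comp q contDiffAt_snd)
  have hc := Real.contDiff_cos.contDiffAt.comp q hA
  have hs := Real.contDiff_sin.contDiffAt.comp q hA
  have hx : ∀ c : V, ContDiffAt ℝ ∞ (fun q : ℝ × V => (inner ℝ c q.2 : ℝ)) q := fun c =>
    contDiffAt_const.inner ℝ contDiffAt_snd
  exact (contDiffAt_snd.add ((((hc.sub contDiffAt_const).mul (hx a)).sub
    (hs.mul (hx b))).smul contDiffAt_const)).add
    (((hs.mul (hx a)).add ((hc.sub contDiffAt_const).mul (hx b))).smul contDiffAt_const)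

/-- Rotation preserves lengths, and the angular velocity `dθ` is multiplied by `1 + t`. -/
theorem norm_fderiv_planeTwist_sq {a b : V} (ha : ‖a‖ = 1) (hb : ‖b‖ = 1)
    (hab : inner ℝ a b = (0 : ℝ)) (t : ℝ) {z : V}
    (hz : planeCoord a b z ∈ Complex.slitPlane) (v : V) :
    ‖fderiv ℝ (planeTwist a b t) z v‖ ^ 2 = ‖v‖ ^ 2 + (2 * t + t ^ 2) *
      ((inner ℝ a z ^ 2 + inner ℝ b z ^ 2) * fderiv ℝ (planeAngle a b) z v ^ 2) := by
  have hA : HasFDerivAt (fun z => t * planeAngle a b z) (t • fderiv ℝ (planeAngle a b) z) z :=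
    (((contDiffAt_planeAngle hz).differentiableAt (by simp)).hasFDerivAt).const_mul t
  have hx : ∀ c : V, HasFDerivAt (fun z : V => (inner ℝ c z : ℝ)) (innerSL ℝ c) z := fun c =>
    (innerSL ℝ c).hasFDerivAt
  have hc := hA.cos
  have hs := hA.sin
  have h := ((hasFDerivAt_id z).add ((((hc.sub_const 1).mul (hx a)).sub
    (hs.mul (hx b))).smul_const a)).add
    (((hs.mul (hx a)).add ((hc.sub_const 1).mul (hx b))).smul_const b)
  have h1 : HasFDerivAt (planeTwist a b t) _ z := h
  have h2 := normSq_mul_fderiv_planeAngle hz v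
  rw [h1.fderiv]
  simp only [add_apply, ContinuousLinearMap.smulRight_apply,
    sub_apply, smul_apply, smul_eq_mul,
    innerSL_apply_apply, ContinuousLinearMap.id_apply]
  rw [norm_add_smul_add_smul_sq ha hb hab]
  set α := fderiv ℝ (planeAngle a b) z v
  have h3 := Real.sin_sq_add_cos_sq (t * planeAngle a b z)
  set S := Real.sin (t * planeAngle a b z)
  set C := Real.cos (t * planeAngle a b z)
  set X : ℝ := inner ℝ a z
  set Y : ℝ := inner ℝ b z
  set P : ℝ := inner ℝ a v
  set Q : ℝ := inner ℝ b v
  linear_combination (P ^ 2 + Q ^ 2 + t ^ 2 * α ^ 2 * (X ^ 2 + Y ^ 2)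
    + 2 * t * α * (X * Q - Y * P)) * h3 - 2 * t * α * h2

/-- The radial projection `y ↦ y / |y|` onto the unit sphere (with value `0` at `0`). -/
def radialProjection (y : V) : V :=
  ‖y‖⁻¹ • y

theorem norm_radialProjection {y : V} (hy : y ≠ 0) : ‖radialProjection y‖ = 1 := by
  rw [radialProjection, norm_smul, norm_inv, norm_norm, inv_mul_cancel₀ (norm_ne_zero_iff.2 hy)]

theorem contDiffAt_radialProjection {y : V} (hy : y ≠ 0) :
    ContDiffAt ℝ ∞ (radialProjection : V → V) y :=
  ((contDiffAt_norm ℝ hy).inv (norm_ne_zero_iff.2 hy)).smul contDiffAt_id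

/-- The differential of the radial projection at `y` divides lengths by at least `|y|`. -/
theorem norm_mul_norm_fderiv_radialProjection_le {y : V} (hy : y ≠ 0) (v : V) :
    ‖y‖ * ‖fderiv ℝ radialProjection y v‖ ≤ ‖v‖ := by
  have hny : ‖y‖ ≠ 0 := norm_ne_zero_iff.2 hy
  have hnorm : DifferentiableAt ℝ (fun y : V => ‖y‖) y :=
    (contDiffAt_norm ℝ hy (n := 1)).differentiableAt (by simp)
  have hN : DifferentiableAt ℝ (radialProjection : V → V) y :=
    (contDiffAt_radialProjection hy).differentiableAt (by simp)
  set N' := fderiv ℝ radialProjection y with hN'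
  have hev : ∀ᶠ x in nhds y, x ≠ 0 := isOpen_ne.mem_nhds hy
  -- `|N|² = 1` gives `⟨N, N'v⟩ = 0`
  have horth : inner ℝ (radialProjection y) (N' v) = 0 := by
    have h1 := hN.hasFDerivAt.norm_sq
    have h2 : HasFDerivAt (fun y : V => ‖radialProjection y‖ ^ 2) (0 : V →L[ℝ] ℝ) y := by
      refine (hasFDerivAt_const (1 : ℝ) y).congr_of_eventuallyEq ?_
      filter_upwards [hev] with x hx
      simp [norm_radialProjection hx]
    have h3 := congrArg (fun L => L v) (h1.unique h2)
    have h4 : inner ℝ y (N' v) = 0 := by simpa [radialProjection, hny] using! h3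
    rw [radialProjection, inner_smul_left, h4, mul_zero]
  -- `y = |y| N` gives `v = (d|y| v) N + |y| N'v`
  have hdec : v = ‖y‖ • N' v + (fderiv ℝ (fun y : V => ‖y‖) y v) • radialProjection y := by
    have h1 := hnorm.hasFDerivAt.smul hN.hasFDerivAt
    have h2 : HasFDerivAt (fun y : V => ‖y‖ • radialProjection y)
        (ContinuousLinearMap.id ℝ V) y := by
      refine (hasFDerivAt_id y).congr_of_eventuallyEq ?_
      filter_upwards [hev] with x hx
      simp [radialProjection, smul_smul, hx]
    have h3 := congrArg (fun L => L v) (h1.unique h2)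
    simpa using! h3.symm
  have hsq : (‖y‖ * ‖N' v‖) ^ 2 ≤ ‖v‖ ^ 2 := by
    conv_rhs => rw [hdec, norm_add_sq_real, norm_smul, inner_smul_left, inner_smul_right,
      real_inner_comm, horth]
    simp only [norm_norm]
    nlinarith [sq_nonneg ‖(fderiv ℝ (fun y : V => ‖y‖) y v) • radialProjection y‖]
  exact (sq_le_sq₀ (by positivity) (norm_nonneg _)).1 hsq

end Plane

/-! ### Smooth variations -/

section Variations

variable {m n : ℕ} {M : Type*} [TopologicalSpace M] [ChartedSpace (EuclideanSpace ℝ (Fin m)) M]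

theorem mvfderiv_comp_apply_fderiv {V W : Type*} [NormedAddCommGroup V] [NormedSpace ℝ V]
    [NormedAddCommGroup W] [NormedSpace ℝ W] {F : M → V} {Φ : V → W}
    (hF : ContMDiff (𝓡 m) 𝓘(ℝ, V) ∞ F) {x : M} (hΦ : DifferentiableAt ℝ Φ (F x))
    (v : TangentSpace (𝓡 m) x) :
    mvfderiv (𝓡 m) (fun x => Φ (F x)) x v = fderiv ℝ Φ (F x) (mvfderiv (𝓡 m) F x v) := by
  have h := mfderiv_comp_apply (I := 𝓡 m) (I' := 𝓘(ℝ, V)) (I'' := 𝓘(ℝ, W)) (g := Φ) (f := F) x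
    hΦ.mdifferentiableAt (hF.mdifferentiable (by simp) x) v
  rw [mfderiv_eq_fderiv] at h
  exact h

/-- A family of maps of the sphere, given by a family `Ψ` of maps of the ambient space that is
smooth near the image of `u`, yields a smooth variation of `u`. -/
theorem contMDiff_sphere_variation [IsManifold (𝓡 m) ∞ M]
    {u : M → sphere (0 : EuclideanSpace ℝ (Fin (n + 1))) 1}
    (hu : ContMDiff (𝓡 m) (𝓡 n) ∞ u)
    {Ψ : ℝ × EuclideanSpace ℝ (Fin (n + 1)) → EuclideanSpace ℝ (Fin (n + 1))}
    (hΨ : ∀ t x, ContDiffAt ℝ ∞ Ψ (t, (u x : EuclideanSpace ℝ (Fin (n + 1)))))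
    {U : ℝ → M → sphere (0 : EuclideanSpace ℝ (Fin (n + 1))) 1}
    (hU : ∀ t x, (U t x : EuclideanSpace ℝ (Fin (n + 1))) = Ψ (t, u x)) :
    ContMDiff (𝓘(ℝ, ℝ).prod (𝓡 m)) (𝓡 n) ∞ (fun q : ℝ × M => U q.1 q.2) := by
  have := Fact.mk (@finrank_euclideanSpace_fin ℝ _ (n + 1))
  have h1 : ContMDiff (𝓘(ℝ, ℝ).prod (𝓡 m)) 𝓘(ℝ, ℝ × EuclideanSpace ℝ (Fin (n + 1))) ∞
      (fun q : ℝ × M => (q.1, (u q.2 : EuclideanSpace ℝ (Fin (n + 1))))) :=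
    contMDiff_fst.prodMk_space ((contMDiff_coe_comp hu).comp contMDiff_snd)
  have h2 : ContMDiff (𝓘(ℝ, ℝ).prod (𝓡 m)) 𝓘(ℝ, EuclideanSpace ℝ (Fin (n + 1))) ∞
      (fun q : ℝ × M => (U q.1 q.2 : EuclideanSpace ℝ (Fin (n + 1)))) := by
    intro q
    have h := (hΨ q.1 q.2).contMDiffAt.comp q (h1 q)
    refine h.congr_of_eventuallyEq (Filter.Eventually.of_forall fun q => ?_)
    exact hU q.1 q.2
  exact h2.codRestrict_sphere fun q => (U q.1 q.2).2

theorem contMDiff_apply_time {U : ℝ → M → sphere (0 : EuclideanSpace ℝ (Fin (n + 1))) 1}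
    (hU : ContMDiff (𝓘(ℝ, ℝ).prod (𝓡 m)) (𝓡 n) ∞ (fun q : ℝ × M => U q.1 q.2)) (t : ℝ) :
    ContMDiff (𝓡 m) (𝓡 n) ∞ (U t) :=
  hU.comp (contMDiff_const.prodMk contMDiff_id : ContMDiff (𝓡 m) (𝓘(ℝ, ℝ).prod (𝓡 m)) ∞
    fun x : M => (t, x))

theorem mvfderiv_eq_zero_of_stdOrthonormalBasis {V : Type*} [NormedAddCommGroup V] [NormedSpace ℝ V]
    [RiemannianBundle (fun x : M => TangentSpace (𝓡 m) x)] {F : M → V} {x : M}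
    (h : ∀ α, mvfderiv (𝓡 m) F x (stdOrthonormalBasis ℝ (TangentSpace (𝓡 m) x) α) = 0) :
    mvfderiv (𝓡 m) F x = 0 := by
  have : (mvfderiv (𝓡 m) F x).toLinearMap = 0 :=
    (stdOrthonormalBasis ℝ (TangentSpace (𝓡 m) x)).toBasis.ext fun α => by simpa using! h α
  ext v
  exact LinearMap.congr_fun this v

end Variations

/-! ### Harmonic maps into the sphere -/

section Harmonic

variable {m n : ℕ} {M : Type*} [TopologicalSpace M] [ChartedSpace (EuclideanSpace ℝ (Fin m)) M]
  [T2Space M] [CompactSpace M] [IsManifold (𝓡 m) ∞ M]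
  [RiemannianBundle (fun x : M => TangentSpace (𝓡 m) x)]
  [IsContMDiffRiemannianBundle (𝓡 m) ∞ (EuclideanSpace ℝ (Fin m))
      (fun x : M => TangentSpace (𝓡 m) x)]
  [MeasurableSpace M] [BorelSpace M]

theorem eq_zero_of_integral_riemannianVolume_eq_zero {g : M → ℝ} (hg : Continuous g)
    (h0 : ∀ x, 0 ≤ g x) (hint : ∫ x, g x ∂(riemannianVolume m M) = 0) (x : M) : g x = 0 := by
  have hi : Integrable g (riemannianVolume m M) :=
    hg.integrable_of_hasCompactSupport (HasCompactSupport.of_compactSpace _)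
  have h1 := (integral_eq_zero_iff_of_nonneg h0 hi).1 hint
  exact congrFun ((hg.ae_eq_iff_eq _ continuous_const).1 h1) x

variable [ConnectedSpace M]

theorem exists_eq_const_of_mapEnergy_nonpos
    {u : M → sphere (0 : EuclideanSpace ℝ (Fin (n + 1))) 1} (hu : ContMDiff (𝓡 m) (𝓡 n) ∞ u)
    (hE : mapEnergy (m := m) (n := n) u ≤ 0) : ∃ c, ∀ x, u x = c := by
  have hE0 : ∫ x, normSqDifferential (m := m) (n := n) u x ∂(riemannianVolume m M) = 0 := by
    have h1 : 0 ≤ ∫ x, normSqDifferential (m := m) (n := n) u x ∂(riemannianVolume m M) :=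
      integral_nonneg fun x => normSqDifferential_nonneg u x
    unfold mapEnergy at hE
    linarith
  have hg := eq_zero_of_integral_riemannianVolume_eq_zero (m := m)
    (continuous_normSqDifferential hu) (normSqDifferential_nonneg u) hE0
  have hd : ∀ x, mvfderiv (𝓡 m) (fun x => (u x : EuclideanSpace ℝ (Fin (n + 1)))) x = 0 := by
    intro x
    refine mvfderiv_eq_zero_of_stdOrthonormalBasis fun α => ?_
    have h := hg x
    rw [normSqDifferential_sphere hu, Finset.sum_eq_zero_iff_of_nonneg fun _ _ => sq_nonneg _] at h
    simpa using h α (Finset.mem_univ α)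
  obtain ⟨c, hc⟩ := exists_eq_const_of_mvfderiv_eq_zero (contMDiff_coe_comp hu) hd
  obtain ⟨x₀⟩ := (inferInstance : Nonempty M)
  exact ⟨u x₀, fun x => Subtype.ext ((hc x).trans (hc x₀).symm)⟩

/-- A harmonic map into an open hemisphere is constant: moving the map towards the pole of the
hemisphere decreases the energy to first order. -/
theorem IsHarmonicMap.exists_eq_const_of_inner_pos
    {u : M → sphere (0 : EuclideanSpace ℝ (Fin (n + 1))) 1} (hu : IsHarmonicMap m n u)
    {c : EuclideanSpace ℝ (Fin (n + 1))} (hc : ‖c‖ = 1)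
    (hpos : ∀ x, 0 < (inner ℝ c (u x : EuclideanSpace ℝ (Fin (n + 1))) : ℝ)) :
    ∃ p, ∀ x, u x = p := by
  have hF := contMDiff_coe_comp hu.1
  have hu1 : ∀ x, ‖(u x : EuclideanSpace ℝ (Fin (n + 1)))‖ = 1 := fun x =>
    norm_eq_of_mem_sphere (u x)
  -- by compactness the height over the equator is bounded below
  obtain ⟨δ, hδ, hδu⟩ :
      ∃ δ : ℝ, 0 < δ ∧ ∀ x, δ ≤ inner ℝ c (u x : EuclideanSpace ℝ (Fin (n + 1))) := by
    obtain ⟨x₀, -, hx₀⟩ := isCompact_univ.exists_isMinOn (univ_nonempty (α := M))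
      (continuous_const.inner hF.continuous : Continuous fun x =>
        (inner ℝ c (u x : EuclideanSpace ℝ (Fin (n + 1))) : ℝ)).continuousOn
    exact ⟨_, hpos x₀, fun x => hx₀ (mem_univ x)⟩
  -- the factor `sin t / 2` keeps `u + s c` away from zero for all times
  let k : ℝ → EuclideanSpace ℝ (Fin (n + 1)) := fun t => (Real.sin t / 2) • c
  have hk : ∀ t x, (u x : EuclideanSpace ℝ (Fin (n + 1))) + k t ≠ 0 := by
    intro t x h0
    have h1 : ‖k t‖ = 1 := by rw [← hu1 x, eq_neg_of_add_eq_zero_left h0, norm_neg]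
    simp only [k, norm_smul, hc, mul_one, Real.norm_eq_abs, abs_div, abs_two] at h1
    have := Real.abs_sin_le_one t
    linarith
  let U : ℝ → M → sphere (0 : EuclideanSpace ℝ (Fin (n + 1))) 1 := fun t x =>
    ⟨radialProjection (u x + k t), by simpa using norm_radialProjection (hk t x)⟩
  have hUs : ContMDiff (𝓘(ℝ, ℝ).prod (𝓡 m)) (𝓡 n) ∞ (fun q : ℝ × M => U q.1 q.2) := by
    refine contMDiff_sphere_variation hu.1 (Ψ := fun q => radialProjection (q.2 + k q.1))
      (fun t x => ?_) fun t x => rfl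
    refine ContDiffAt.comp (f := fun q : ℝ × EuclideanSpace ℝ (Fin (n + 1)) => q.2 + k q.1)
      (t, (u x : EuclideanSpace ℝ (Fin (n + 1)))) (contDiffAt_radialProjection (hk t x)) ?_
    have : ContDiff ℝ ∞ fun q : ℝ × EuclideanSpace ℝ (Fin (n + 1)) => q.2 + k q.1 :=
      contDiff_snd.add (((Real.contDiff_sin.comp contDiff_fst).div_const 2).smul contDiff_const)
    exact this.contDiffAt
  have hU0 : U 0 = u := by
    funext x
    apply Subtype.ext
    simp [U, radialProjection, k, hu1]
  have hder := hu.2 U hUs hU0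
  -- the energy density shrinks by the factor `1 + δ sin t`
  have hdens : ∀ t, 0 ≤ Real.sin t → ∀ x, (1 + δ * Real.sin t) *
      normSqDifferential (m := m) (n := n) (U t) x ≤ normSqDifferential (m := m) (n := n) u x := by
    intro t ht x
    rw [normSqDifferential_sphere (contMDiff_apply_time hUs t), normSqDifferential_sphere hu.1,
      Finset.mul_sum]
    refine Finset.sum_le_sum fun α _ => ?_
    set e := stdOrthonormalBasis ℝ (TangentSpace (𝓡 m) x) α
    set y := (u x : EuclideanSpace ℝ (Fin (n + 1))) + k t with hy
    set w := mvfderiv (𝓡 m) (fun x => (u x : EuclideanSpace ℝ (Fin (n + 1)))) x e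
    have h1 : mvfderiv (𝓡 m) (fun x => (U t x : EuclideanSpace ℝ (Fin (n + 1)))) x e =
        fderiv ℝ radialProjection y w := by
      have h := mvfderiv_comp_apply_fderiv (x := x) hF
        (Φ := fun z => radialProjection (z + k t))
        (((contDiffAt_radialProjection (hk t x)).differentiableAt (by simp)).comp
          (f := fun z => z + k t) _ (differentiableAt_id.add_const _)) e
      rw [fderiv_comp_add_right] at h
      exact h
    have h2 : 1 + δ * Real.sin t ≤ ‖y‖ ^ 2 := by
      rw [hy, norm_add_sq_real, hu1, inner_smul_right, real_inner_comm]
      have := mul_le_mul_of_nonneg_right (hδu x) ht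
      nlinarith [sq_nonneg ‖k t‖]
    have h3 := norm_mul_norm_fderiv_radialProjection_le (hk t x) w
    rw [h1]
    calc (1 + δ * Real.sin t) * ‖fderiv ℝ radialProjection y w‖ ^ 2
        ≤ ‖y‖ ^ 2 * ‖fderiv ℝ radialProjection y w‖ ^ 2 := by
          gcongr
      _ = (‖y‖ * ‖fderiv ℝ radialProjection y w‖) ^ 2 := by ring
      _ ≤ ‖w‖ ^ 2 := by gcongr
  have hen : ∀ t, 0 ≤ Real.sin t → (1 + δ * Real.sin t) * mapEnergy (m := m) (n := n) (U t) ≤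
      mapEnergy (m := m) (n := n) u := by
    intro t ht
    have h := integral_mono ((integrable_normSqDifferential (contMDiff_apply_time hUs t)).const_mul
      (1 + δ * Real.sin t)) (integrable_normSqDifferential hu.1) (hdens t ht)
    simp only [integral_const_mul] at h
    unfold mapEnergy
    linarith
  -- compare the right derivatives at time zero
  have hh : HasDerivAt (fun t => (1 + δ * Real.sin t) * mapEnergy (m := m) (n := n) (U t))
      (δ * mapEnergy (m := m) (n := n) u) 0 := by
    have h := (((Real.hasDerivAt_sin 0).const_mul δ).const_add 1).mul hder
    simpa [hU0] using! h
  have hle : δ * mapEnergy (m := m) (n := n) u ≤ 0 := by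
    refine le_of_tendsto hh.tendsto_slope_zero_right ?_
    filter_upwards [Ioo_mem_nhdsGT Real.pi_pos] with t ht
    have h := hen t (Real.sin_nonneg_of_mem_Icc (Ioo_subset_Icc_self ht))
    simp only [zero_add, Real.sin_zero, mul_zero, add_zero, one_mul, hU0, smul_eq_mul]
    exact mul_nonpos_of_nonneg_of_nonpos (inv_nonneg.2 ht.1.le) (by linarith)
  exact exists_eq_const_of_mapEnergy_nonpos hu.1 (nonpos_of_mul_nonpos_right hle hδ)

/-- If a harmonic map avoids the slit `{⟨a, x⟩ = 0, ⟨b, x⟩ ≥ 0}`, then its angular coordinate in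
the plane of `a` and `b` is constant. -/
theorem IsHarmonicMap.exists_planeAngle_eq_const
    {u : M → sphere (0 : EuclideanSpace ℝ (Fin (n + 1))) 1} (hu : IsHarmonicMap m n u)
    {a b : EuclideanSpace ℝ (Fin (n + 1))} (ha : ‖a‖ = 1) (hb : ‖b‖ = 1)
    (hab : inner ℝ a b = (0 : ℝ))
    (hslit : ∀ x, planeCoord a b (u x : EuclideanSpace ℝ (Fin (n + 1))) ∈ Complex.slitPlane) :
    ∃ θ, ∀ x, planeAngle a b (u x : EuclideanSpace ℝ (Fin (n + 1))) = θ := by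
  have hF := contMDiff_coe_comp hu.1
  let U : ℝ → M → sphere (0 : EuclideanSpace ℝ (Fin (n + 1))) 1 := fun t x =>
    ⟨planeTwist a b t (u x), by simp [planeTwist, norm_planeRotation ha hb hab]⟩
  have hUs : ContMDiff (𝓘(ℝ, ℝ).prod (𝓡 m)) (𝓡 n) ∞ (fun q : ℝ × M => U q.1 q.2) :=
    contMDiff_sphere_variation hu.1 (Ψ := fun q => planeTwist a b q.1 q.2)
      (fun t x => contDiffAt_planeTwist _ (hslit x)) fun t x => rfl
  have hU0 : U 0 = u := by
    funext x
    exact Subtype.ext (planeTwist_zero a b _)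
  have hder := hu.2 U hUs hU0
  -- `g = r² |dθ|²`
  let g : M → ℝ := fun x => ∑ α,
    (inner ℝ a (u x : EuclideanSpace ℝ (Fin (n + 1))) ^ 2 +
      inner ℝ b (u x : EuclideanSpace ℝ (Fin (n + 1))) ^ 2) *
    mvfderiv (𝓡 m) (fun x => planeAngle a b (u x : EuclideanSpace ℝ (Fin (n + 1)))) x
      (stdOrthonormalBasis ℝ (TangentSpace (𝓡 m) x) α) ^ 2
  have hdens : ∀ t x, normSqDifferential (m := m) (n := n) (U t) x =
      normSqDifferential (m := m) (n := n) u x + (2 * t + t ^ 2) * g x := by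
    intro t x
    rw [normSqDifferential_sphere (contMDiff_apply_time hUs t), normSqDifferential_sphere hu.1,
      Finset.mul_sum, ← Finset.sum_add_distrib]
    refine Finset.sum_congr rfl fun α _ => ?_
    set e := stdOrthonormalBasis ℝ (TangentSpace (𝓡 m) x) α
    have hdA := mvfderiv_comp_apply_fderiv (x := x) hF
      ((contDiffAt_planeAngle (hslit x)).differentiableAt (by simp)) e
    have hdU := mvfderiv_comp_apply_fderiv (x := x) hF (Φ := planeTwist a b t)
      (((contDiffAt_planeTwist (t, (u x : EuclideanSpace ℝ (Fin (n + 1)))) (hslit x)).comp _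
        (contDiffAt_const.prodMk contDiffAt_id)).differentiableAt (by simp)) e
    rw [hdA, ← norm_fderiv_planeTwist_sq ha hb hab t (hslit x), ← hdU]
  have hgc : Continuous g := by
    have h : g = fun x => (normSqDifferential (m := m) (n := n) (U 1) x -
        normSqDifferential (m := m) (n := n) u x) / 3 := by
      funext x
      rw [hdens 1 x]
      ring
    rw [h]
    exact ((continuous_normSqDifferential (contMDiff_apply_time hUs 1)).sub
      (continuous_normSqDifferential hu.1)).div_const 3
  have hg0 : ∀ x, 0 ≤ g x := fun x => Finset.sum_nonneg fun α _ => by positivity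
  have hgi : Integrable g (riemannianVolume m M) :=
    hgc.integrable_of_hasCompactSupport (HasCompactSupport.of_compactSpace _)
  have hE : (fun t => mapEnergy (m := m) (n := n) (U t)) = fun t =>
      mapEnergy (m := m) (n := n) u + (t + t ^ 2 / 2) * ∫ x, g x ∂(riemannianVolume m M) := by
    funext t
    unfold mapEnergy
    simp only [hdens]
    rw [integral_add (integrable_normSqDifferential hu.1) (hgi.const_mul _), integral_const_mul]
    ring
  have hint : ∫ x, g x ∂(riemannianVolume m M) = 0 := by
    rw [hE] at hder
    have h := ((((hasDerivAt_id (0 : ℝ)).add ((hasDerivAt_pow 2 (0 : ℝ)).div_const 2)).mul_const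
      (∫ x, g x ∂(riemannianVolume m M))).const_add (mapEnergy (m := m) (n := n) u))
    simpa using! h.unique hder
  have hgz := eq_zero_of_integral_riemannianVolume_eq_zero (m := m) hgc hg0 hint
  have hA : ContMDiff (𝓡 m) 𝓘(ℝ, ℝ) ∞
      fun x => planeAngle a b (u x : EuclideanSpace ℝ (Fin (n + 1))) := fun x =>
    ContMDiffAt.comp (g := planeAngle a b) x
      (contDiffAt_planeAngle (hslit x)).contMDiffAt (hF x)
  refine exists_eq_const_of_mvfderiv_eq_zero hA fun x =>
    mvfderiv_eq_zero_of_stdOrthonormalBasis fun α => ?_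
  have h := (Finset.sum_eq_zero_iff_of_nonneg fun _ _ => by positivity).1 (hgz x) α
    (Finset.mem_univ α)
  have hr : inner ℝ a (u x : EuclideanSpace ℝ (Fin (n + 1))) ^ 2 +
      inner ℝ b (u x : EuclideanSpace ℝ (Fin (n + 1))) ^ 2 ≠ (0 : ℝ) := by
    intro h0
    refine Complex.slitPlane_ne_zero (hslit x) (Complex.ext ?_ ?_)
    · simp only [planeCoord_re, Complex.zero_re]; nlinarith
    · simp only [planeCoord_im, Complex.zero_im]; nlinarith
  simpa [hr] using h

end Harmonic

end

theorem mainTheorem7 (m n : ℕ) {M : Type*}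
    [TopologicalSpace M] [T2Space M] [CompactSpace M] [ConnectedSpace M]
    [ChartedSpace (EuclideanSpace ℝ (Fin m)) M] [IsManifold (𝓡 m) ∞ M]
    [RiemannianBundle (fun x : M => TangentSpace (𝓡 m) x)]
    [IsContMDiffRiemannianBundle (𝓡 m) ∞ (EuclideanSpace ℝ (Fin m))
      (fun x : M => TangentSpace (𝓡 m) x)]
    [MeasurableSpace M] [BorelSpace M]
    (a b : EuclideanSpace ℝ (Fin (n + 1)))
    (ha : ‖a‖ = 1) (hb : ‖b‖ = 1) (hab : inner ℝ a b = (0 : ℝ))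
    (u : M → sphere (0 : EuclideanSpace ℝ (Fin (n + 1))) 1)
    (hu : IsHarmonicMap m n u)
    (himage : range u ⊆ (closedHalfEquator a b)ᶜ) :
    ∃ c : sphere (0 : EuclideanSpace ℝ (Fin (n + 1))) 1, ∀ x : M, u x = c := by
  have hslit : ∀ x, planeCoord a b (u x : EuclideanSpace ℝ (Fin (n + 1))) ∈
      Complex.slitPlane := by
    intro x
    rw [Complex.mem_slitPlane_iff, planeCoord_re, planeCoord_im]
    by_contra! h
    refine himage (mem_range_self x) ⟨?_, ?_⟩
    · rw [real_inner_comm]; exact h.2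
    · rw [real_inner_comm]; linarith [h.1]
  obtain ⟨θ, hθ⟩ := hu.exists_planeAngle_eq_const ha hb hab hslit
  -- the half-plane of angle `θ` lies in the open hemisphere centred at its direction
  refine hu.exists_eq_const_of_inner_pos (c := Real.sin θ • a - Real.cos θ • b) ?_ fun x => ?_
  · have h : ‖Real.sin θ • a - Real.cos θ • b‖ ^ 2 = 1 := by
      rw [norm_sub_sq_real, norm_smul, norm_smul, ha, hb, inner_smul_left, inner_smul_right, hab]
      simp
    nlinarith [norm_nonneg (Real.sin θ • a - Real.cos θ • b)]
  · set w := planeCoord a b (u x : EuclideanSpace ℝ (Fin (n + 1))) with hw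
    have hw0 : w ≠ 0 := Complex.slitPlane_ne_zero (hslit x)
    have harg : w.arg = θ := by rw [← hθ x, planeAngle, Complex.log_im]
    have hre : inner ℝ b (u x : EuclideanSpace ℝ (Fin (n + 1))) = -(‖w‖ * Real.cos θ) := by
      rw [← harg, Complex.norm_mul_cos_arg, hw, planeCoord_re, neg_neg]
    have him : inner ℝ a (u x : EuclideanSpace ℝ (Fin (n + 1))) = ‖w‖ * Real.sin θ := by
      rw [← harg, Complex.norm_mul_sin_arg, hw, planeCoord_im]
    have hval : inner ℝ (Real.sin θ • a - Real.cos θ • b)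
        (u x : EuclideanSpace ℝ (Fin (n + 1))) = ‖w‖ := by
      rw [inner_sub_left, inner_smul_left, inner_smul_left, hre, him]
      simp only [conj_trivial]
      linear_combination ‖w‖ * Real.sin_sq_add_cos_sq θ
    rw [hval]
    exact norm_pos_iff.2 hw0
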